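/- For a finite simple graph $G$, let $\operatorname{tww}(G)$ denote its twin-width: the minimum $d$ such that $G$, regarded as a trigraph without red edges, can be reduced to a one-vertex trigraph by successively contracting pairs of distinct vertices so that in every trigraph of the sequence each vertex is incident with at most $d$ red edges. (A trigraph has disjoint sets of black and red edges. Contracting $u$ and $v$ replaces them by a new vertex $w$ and changes nothing among the other vertices; for every other vertex $x$, $wx$ is a black edge if both $ux$ and $vx$ are black edges, $wx$ is a non-edge if neither $ux$ nor $vx$ is an edge, and $wx$ is a red edge otherwise.) Let $G(n,p)$ denote the random graph on $n$ labelled vertices in which each pair of vertices is adjacent independently with probability $p$. There exist absolute constants $c, C > 0$ such that for every function $p\colon \mathbb{N} \to [0,1]$ with $$\frac{726 \ln n}{n} \le p(n) \le \frac12 \quad \text{for all sufficiently large } n,$$ one has, with $p = p(n)$, $$\lim_{n \to \infty} \Pr\bigl[\, c\, n\sqrt{p} \le \operatorname{tww}(G(n,p)) \le C\, n\sqrt{p} \,\bigr] = 1.$$ That is, with high probability $\operatorname{tww}(G(n,p)) = \Theta(n\sqrt{p})$. -/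

import Mathlib

open Filter Topology

universe u

/-- A trigraph on the vertex type `V`: two disjoint sets of (unordered, loopless) edges,
the black edges and the red edges. -/
@[ext]
structure Trigraph (V : Type u) where
  black : SimpleGraph V
  red : SimpleGraph V
  disj : Disjoint black red

namespace Trigraph

variable {V : Type u}

/-- A graph, regarded as a trigraph without red edges. -/
def ofGraph (G : SimpleGraph V) : Trigraph V where
  black := G
  red := ⊥
  disj := disjoint_bot_right

/-- The graph of all edges (black or red) of a trigraph. -/
def edges (G : Trigraph V) : SimpleGraph V := G.black ⊔ G.red

/-- The red-degree of `v`: the number of red edges incident with `v`. -/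
noncomputable def redDegree (G : Trigraph V) (v : V) : ℕ := (G.red.neighborSet v).ncard

/-- Delete `u` and `v` from the graph `H` and add a new vertex `w` (represented by `none`) that is
adjacent to exactly those remaining vertices `x` with `P x`. -/
def replacePair (H : SimpleGraph V) (u v : V) (P : V → Prop) :
    SimpleGraph (Option {x : V // x ≠ u ∧ x ≠ v}) where
  Adj
    | some x, some y => H.Adj x y
    | none, some x => P x
    | some x, none => P x
    | none, none => False
  symm := ⟨by
    rintro (_ | x) (_ | y) h
    · exact h
    · exact h
    · exact h
    · exact H.adj_symm h⟩
  loopless := ⟨by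
    rintro (_ | x) h
    · exact h
    · exact H.irrefl h⟩

/-- The trigraph `G / {u, v}` obtained from `G` by contracting `u` and `v` to a new vertex `w`
(represented by `none`): nothing changes away from `w`; the edge `wx` is black if both `ux` and `vx`
are black, it is absent if neither `ux` nor `vx` is an edge, and it is red otherwise. -/
def contract (G : Trigraph V) (u v : V) : Trigraph (Option {x : V // x ≠ u ∧ x ≠ v}) where
  black := replacePair G.black u v fun x => G.black.Adj u x ∧ G.black.Adj v x
  red := replacePair G.red u v fun x =>
    ¬ (G.black.Adj u x ∧ G.black.Adj v x) ∧ ¬ (¬ G.edges.Adj u x ∧ ¬ G.edges.Adj v x)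
  disj := by
    rw [SimpleGraph.disjoint_left]
    rintro (_ | x) (_ | y) h h'
    · exact h
    · exact h'.1 h
    · exact h'.1 h
    · exact SimpleGraph.disjoint_left.1 G.disj _ _ h h'

/-- `HasContractionSeq d G`: there is a `d`-contraction sequence of `G`, that is, a sequence of
trigraphs that starts with `G`, ends with a one-vertex trigraph, in which each term but the first is
obtained from its predecessor by contracting two distinct vertices, and in which every vertex of
every term has red-degree at most `d`. -/
inductive HasContractionSeq (d : ℕ) : {V : Type u} → Trigraph V → Prop
  | single {V : Type u} (G : Trigraph V) (hd : ∀ x, G.redDegree x ≤ d) (h : Nat.card V = 1) :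
      HasContractionSeq d G
  | step {V : Type u} (G : Trigraph V) (hd : ∀ x, G.redDegree x ≤ d) (u v : V) (huv : u ≠ v)
      (h : HasContractionSeq d (G.contract u v)) : HasContractionSeq d G

theorem card_contract [Finite V] {u v : V} (huv : u ≠ v) :
    Nat.card (Option {x : V // x ≠ u ∧ x ≠ v}) + 1 = Nat.card V := by
  classical
  have := Fintype.ofFinite V
  have h1 : (({u, v} : Finset V)ᶜ).card + ({u, v} : Finset V).card = Fintype.card V :=
    Finset.card_compl_add_card _
  rw [Finset.card_pair huv] at h1
  rw [Finite.card_option, Nat.card_eq_fintype_card, Nat.card_eq_fintype_card,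
    Fintype.card_of_subtype ({u, v} : Finset V)ᶜ (by simp)]
  omega

/-- Every nonempty finite trigraph has a `d`-contraction sequence for some `d`. -/
theorem exists_hasContractionSeq [Finite V] [Nonempty V] (G : Trigraph V) :
    ∃ d, HasContractionSeq d G := by
  have red_le : ∀ {W : Type u} [Finite W] (H : Trigraph W) (x : W),
      H.redDegree x ≤ Nat.card W := fun H x => Set.ncard_le_card _
  have key : ∀ (N k : ℕ) (W : Type u) [Finite W] (H : Trigraph W),
      Nat.card W = k + 1 → k + 1 ≤ N → HasContractionSeq N H := by
    intro N k
    induction k with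
    | zero => exact fun W _ H hk hN => .single H (fun x => (red_le H x).trans (by omega)) hk
    | succ k ih =>
      intro W _ H hk hN
      have : Nontrivial W := Finite.one_lt_card_iff_nontrivial.1 (by omega)
      obtain ⟨u, v, huv⟩ := exists_pair_ne W
      refine .step H (fun x => (red_le H x).trans (by omega)) u v huv (ih _ _ ?_ (by omega))
      have := card_contract huv
      omega
  have hpos : 0 < Nat.card V := Nat.card_pos
  exact ⟨Nat.card V, key _ (Nat.card V - 1) V G (by omega) (by omega)⟩

end Trigraph

/-- The twin-width of a finite graph: the minimum `d` such that it has a `d`-contraction sequence.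
(The minimum is over a nonempty set as soon as the graph has a vertex.) -/
noncomputable def twinWidth {V : Type u} [Finite V] (G : SimpleGraph V) : ℕ :=
  sInf {d : ℕ | (Trigraph.ofGraph G).HasContractionSeq d}

/-! Put `s = ⌈1/√p⌉`. Every trigraph in a contraction sequence of `G` is the quotient of `G` by a
partition of its vertices (`contract_quotient`), with red edges between the parts that span both an
edge and a non-edge.

Upper bound: merge consecutive vertices into blocks of size `s`. A block has red degree at most
`sΔ`, where `Δ = O(pn)` bounds the degrees with high probability. A vertex not yet absorbed is red
only to blocks, of which there are at most `n/s + 1`. Both bounds are `O(n√p)`, and once only the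
blocks remain any order of contraction will do (`twinWidth_le_of_degree_le`).

Lower bound: stop the sequence when half of the vertices first lie in parts of size at least `s`.
One contraction changes little, so nearly half still lie in smaller parts
(`HasContractionSeq.exists_balanced`). If the twin-width is at most `d`, every large part is mixed
with at most `d` small ones. For a fixed partition, an exponential moment bound over the independent
pairs (large part, small part) gives this probability at most `exp(-pn²/64)` when `d ≤ n√p/64`
(`binomialRandom_real_fewMixed_le`). This beats the at most `n ^ n` partitions as soon as `pn` is a
large multiple of `ln n`. -/

namespace Trigraph

/-! ### Contraction sequences as sequences of partitions -/

section Quotient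

variable {V : Type*} {W : Type u}

/-- The fibres of `f` over `a` and `b` are mixed in `G` if they span both an edge and a non-edge. -/
def Mixed (G : SimpleGraph V) (f : V → W) (a b : W) : Prop :=
  (∃ x y, f x = a ∧ f y = b ∧ G.Adj x y) ∧ ∃ x y, f x = a ∧ f y = b ∧ ¬ G.Adj x y

theorem Mixed.symm {G : SimpleGraph V} {f : V → W} {a b : W} (h : Mixed G f a b) :
    Mixed G f b a := by
  obtain ⟨⟨x, y, hx, hy, h1⟩, x', y', hx', hy', h2⟩ := h
  exact ⟨⟨y, x, hy, hx, h1.symm⟩, y', x', hy', hx', fun h => h2 h.symm⟩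

/-- The trigraph obtained from `G` by contracting every fibre of `f` to one vertex. -/
def quotient (G : SimpleGraph V) (f : V → W) : Trigraph W where
  black :=
    { Adj := fun a b => a ≠ b ∧ ∀ x y, f x = a → f y = b → G.Adj x y
      symm := ⟨fun _ _ h => ⟨h.1.symm, fun x y hx hy => (h.2 y x hy hx).symm⟩⟩
      loopless := ⟨fun _ h => h.1 rfl⟩ }
  red :=
    { Adj := fun a b => a ≠ b ∧ Mixed G f a b
      symm := ⟨fun _ _ h => ⟨h.1.symm, h.2.symm⟩⟩
      loopless := ⟨fun _ h => h.1 rfl⟩ }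
  disj := by
    rw [SimpleGraph.disjoint_left]
    rintro a b ⟨_, h⟩ ⟨_, _, x, y, hx, hy, hxy⟩
    exact hxy (h x y hx hy)

theorem quotient_id (G : SimpleGraph W) : quotient G id = ofGraph G := by
  ext a b
  · simp only [quotient, ofGraph, id]
    exact ⟨fun h => h.2 a b rfl rfl, fun h => ⟨h.ne, by rintro x y rfl rfl; exact h⟩⟩
  · simp only [quotient, ofGraph, id, Mixed, SimpleGraph.bot_adj, iff_false]
    rintro ⟨-, ⟨x, y, rfl, rfl, h⟩, x', y', rfl, rfl, h'⟩
    exact h' h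

open Classical in
/-- The map that identifies `u` and `v`. -/
noncomputable def identify (u v : W) (x : W) : Option {x : W // x ≠ u ∧ x ≠ v} :=
  if h : x ≠ u ∧ x ≠ v then some ⟨x, h⟩ else none

theorem identify_eq_none {u v x : W} : identify u v x = none ↔ x = u ∨ x = v := by
  unfold identify
  split_ifs with h
  · simp [h.1, h.2]
  · simp only [true_iff]; tauto

theorem identify_eq_some {u v x : W} {y : {x : W // x ≠ u ∧ x ≠ v}} :
    identify u v x = some y ↔ x = y := by
  unfold identify
  split_ifs with h
  · simp [Subtype.ext_iff]
  · simp only [false_iff]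
    rintro rfl
    exact h y.2

theorem identify_eq_identify {u v x y : W} :
    identify u v x = identify u v y ↔ x = y ∨ (x = u ∨ x = v) ∧ (y = u ∨ y = v) := by
  rcases h : identify u v y with _ | z
  · rw [identify_eq_none] at h ⊢
    constructor
    · tauto
    · rintro (rfl | h) <;> tauto
  · rw [identify_eq_some] at h ⊢
    have h1 := z.2.1
    have h2 := z.2.2
    rw [← h] at h1 h2
    rw [← h]
    tauto

theorem identify_surjective (u v : W) : Function.Surjective (identify u v) := by
  rintro (_ | y)
  · exact ⟨u, identify_eq_none.2 (.inl rfl)⟩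
  · exact ⟨y, identify_eq_some.2 rfl⟩

/-- Lets partitions stand in for trigraphs throughout. Surjectivity matters: over an empty fibre the
black relation of `quotient` holds vacuously, without any actual edge. -/
theorem contract_quotient (G : SimpleGraph V) {f : V → W} (hf : Function.Surjective f) (u v : W) :
    (quotient G f).contract u v = quotient G (identify u v ∘ f) := by
  have hu := hf u
  have hv := hf v
  obtain ⟨xu, hxu⟩ := hu
  obtain ⟨xv, hxv⟩ := hv
  have edges_iff : ∀ a b, (quotient G f).edges.Adj a b ↔
      a ≠ b ∧ ∃ x y, f x = a ∧ f y = b ∧ G.Adj x y := by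
    intro a b
    simp only [edges, quotient, SimpleGraph.sup_adj, Mixed]
    constructor
    · rintro (⟨h, h'⟩ | ⟨h, h', -⟩)
      · obtain ⟨x, rfl⟩ := hf a
        obtain ⟨y, rfl⟩ := hf b
        exact ⟨h, x, y, rfl, rfl, h' x y rfl rfl⟩
      · exact ⟨h, h'⟩
    · rintro ⟨h, h'⟩
      by_cases hh : ∀ x y, f x = a → f y = b → G.Adj x y
      · exact .inl ⟨h, hh⟩
      · push Not at hh
        obtain ⟨x, y, h1, h2, h3⟩ := hh
        exact .inr ⟨h, h', x, y, h1, h2, h3⟩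
  have black_none : ∀ x : {x : W // x ≠ u ∧ x ≠ v},
      ((quotient G f).black.Adj u x ∧ (quotient G f).black.Adj v x) ↔
        ∀ z w, identify u v (f z) = none → identify u v (f w) = some x → G.Adj z w := by
    intro x
    simp only [identify_eq_none, identify_eq_some, quotient]
    have := x.2.1
    have := x.2.2
    constructor
    · rintro ⟨⟨_, h1⟩, ⟨_, h2⟩⟩ z w (h | h) hw
      · exact h1 z w h hw
      · exact h2 z w h hw
    · intro h
      exact ⟨⟨x.2.1.symm, fun z w hz hw => h z w (.inl hz) hw⟩,
        ⟨x.2.2.symm, fun z w hz hw => h z w (.inr hz) hw⟩⟩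
  have red_none : ∀ x : {x : W // x ≠ u ∧ x ≠ v},
      (¬ ((quotient G f).black.Adj u x ∧ (quotient G f).black.Adj v x) ∧
        ¬ (¬ (quotient G f).edges.Adj u x ∧ ¬ (quotient G f).edges.Adj v x)) ↔
        Mixed G (identify u v ∘ f) none (some x) := by
    intro x
    rw [black_none, edges_iff, edges_iff, Mixed, and_comm]
    simp only [Function.comp_apply, identify_eq_none, identify_eq_some]
    refine and_congr ?_ ?_
    · rw [not_and_or, not_not, not_not]
      constructor
      · rintro (⟨-, z, w, hz, hw, h⟩ | ⟨-, z, w, hz, hw, h⟩)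
        · exact ⟨z, w, .inl hz, hw, h⟩
        · exact ⟨z, w, .inr hz, hw, h⟩
      · rintro ⟨z, w, hz | hz, hw, h⟩
        · exact .inl ⟨x.2.1.symm, z, w, hz, hw, h⟩
        · exact .inr ⟨x.2.2.symm, z, w, hz, hw, h⟩
    · push Not
      rfl
  ext a b
  · rcases a with _ | a <;> rcases b with _ | b
    · exact ⟨fun h => (SimpleGraph.irrefl _ h).elim, fun h => (SimpleGraph.irrefl _ h).elim⟩
    · refine (black_none b).trans ⟨fun h => ⟨by simp, h⟩, fun h => h.2⟩
    · refine (black_none a).trans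
        ⟨fun h => ⟨by simp, fun z w hz hw => (h w z hw hz).symm⟩,
          fun h z w hz hw => (h.2 w z hw hz).symm⟩
    · simp [contract, replacePair, quotient, identify_eq_some, Subtype.ext_iff]
  · rcases a with _ | a <;> rcases b with _ | b
    · exact ⟨fun h => (SimpleGraph.irrefl _ h).elim, fun h => (SimpleGraph.irrefl _ h).elim⟩
    · refine (red_none b).trans ⟨fun h => ⟨by simp, h⟩, fun h => h.2⟩
    · refine (red_none a).trans ⟨fun h => ⟨by simp, h.symm⟩, fun h => h.2.symm⟩
    · simp [contract, replacePair, quotient, Mixed, identify_eq_some, Subtype.ext_iff]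

end Quotient

theorem HasContractionSeq.redDegree_le {d : ℕ} {W : Type u} {T : Trigraph W}
    (h : HasContractionSeq d T) (x : W) : T.redDegree x ≤ d := by
  cases h with
  | single _ hd _ => exact hd x
  | step _ hd _ _ _ _ => exact hd x

theorem hasContractionSeq_of_card_le {d k : ℕ} {W : Type u} [Finite W] (T : Trigraph W)
    (hk : Nat.card W = k + 1) (hd : k + 1 ≤ d) : HasContractionSeq d T := by
  have red_le : ∀ {W : Type u} [Finite W] (H : Trigraph W) (x : W),
      H.redDegree x ≤ Nat.card W := fun H x => Set.ncard_le_card _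
  induction k generalizing W with
  | zero => exact .single T (fun x => (red_le T x).trans (by omega)) hk
  | succ k ih =>
    have : Nontrivial W := Finite.one_lt_card_iff_nontrivial.1 (by omega)
    obtain ⟨u, v, huv⟩ := exists_pair_ne W
    have := card_contract huv
    exact .step T (fun x => (red_le T x).trans (by omega)) u v huv (ih _ (by omega) (by omega))

/-! ### Upper bound by merging blocks of consecutive vertices -/

section Blocks

variable {n : ℕ}

/-- The partition of `Fin n` in which the vertices below `t` are grouped into blocks of `s`
consecutive vertices, and all others are singletons. -/
def IsBlockMap {W : Type u} (s t : ℕ) (f : Fin n → W) : Prop :=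
  ∀ x y, f x = f y ↔ x = y ∨ (x : ℕ) / s = (y : ℕ) / s ∧ (x : ℕ) < t ∧ (y : ℕ) < t

/-- A red neighbour of a block contains a neighbour of one of its at most `s` vertices, which gives
`s * Δ`. Two singletons are never mixed, so a singleton is red only to blocks, and these are told
apart by their quotient `x / s ≤ n / s`. -/
theorem IsBlockMap.redDegree_le {W : Type u} {s t d Δ : ℕ} {f : Fin n → W} (hs : 0 < s)
    (h : IsBlockMap s t f) (hf : Function.Surjective f) (G : SimpleGraph (Fin n))
    (hΔ : ∀ v, (G.neighborSet v).ncard ≤ Δ) (h1 : s * Δ ≤ d) (h2 : n / s + 1 ≤ d) (w : W) :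
    (quotient G f).redDegree w ≤ d := by
  classical
  obtain ⟨v, rfl⟩ := hf w
  by_cases hv : (v : ℕ) < t
  · refine le_trans ?_ h1
    have hsub : (quotient G f).red.neighborSet (f v) ⊆
        (((Finset.univ.filter fun x : Fin n => (x : ℕ) / s = (v : ℕ) / s).biUnion
          fun x => G.neighborFinset x).image f : Finset W) := by
      rintro b ⟨-, ⟨x, y, hx, rfl, hxy⟩, -⟩
      simp only [Finset.coe_image, Set.mem_image, Finset.mem_coe, Finset.mem_biUnion,
        Finset.mem_filter, Finset.mem_univ, true_and, SimpleGraph.mem_neighborFinset]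
      refine ⟨y, ⟨x, ?_, hxy⟩, rfl⟩
      rcases (h x v).1 hx with rfl | hx
      · rfl
      · exact hx.1
    refine (Set.ncard_le_ncard hsub (Finset.finite_toSet _)).trans ?_
    rw [Set.ncard_coe_finset]
    refine Finset.card_image_le.trans ((Finset.card_biUnion_le_card_mul _ _ Δ fun x _ => ?_).trans
      (Nat.mul_le_mul_right _ ?_))
    · refine le_trans (le_of_eq ?_) (hΔ x)
      rw [← Set.ncard_coe_finset, SimpleGraph.coe_neighborFinset]
    · calc _ ≤ (Finset.range s).card := by
            refine Finset.card_le_card_of_injOn (fun x : Fin n => (x : ℕ) % s)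
              (fun x _ => by simpa using Nat.mod_lt _ hs) ?_
            intro x hx y hy hxy
            simp only [Finset.coe_filter, Finset.mem_univ, true_and, Set.mem_ofPred_eq] at hx hy hxy
            ext
            rw [← Nat.div_add_mod x s, ← Nat.div_add_mod y s, hx, hy, hxy]
        _ = s := Finset.card_range s
  · refine le_trans ?_ h2
    have hlt : ∀ b, (quotient G f).red.Adj (f v) b → ((Function.surjInv hf b : Fin n) : ℕ) < t := by
      rintro b ⟨hb, ⟨x, y, hx, hy, hxy⟩, x', y', hx', hy', hxy'⟩
      by_contra hlt
      have hsb := Function.surjInv_eq hf b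
      set z := Function.surjInv hf b
      have e1 := (h x v).1 hx
      have e2 := (h x' v).1 hx'
      have e3 := (h y z).1 (hy.trans hsb.symm)
      have e4 := (h y' z).1 (hy'.trans hsb.symm)
      obtain rfl : x = v := by tauto
      obtain rfl : x' = x := by tauto
      obtain rfl : y = z := by tauto
      obtain rfl : y' = z := by tauto
      exact hxy' hxy
    calc _ ≤ (↑(Finset.range (n / s + 1)) : Set ℕ).ncard := by
          refine Set.ncard_le_ncard_of_injOn (fun b => ((Function.surjInv hf b : Fin n) : ℕ) / s)
            ?_ ?_ (Finset.finite_toSet _)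
          · intro b _
            simp only [Finset.coe_range, Set.mem_Iio]
            exact Nat.lt_succ_of_le (Nat.div_le_div_right (Fin.is_lt _).le)
          · intro b hb b' hb' hbb
            have := (h (Function.surjInv hf b) (Function.surjInv hf b')).2
              (.inr ⟨hbb, hlt b hb, hlt b' hb'⟩)
            rwa [Function.surjInv_eq hf, Function.surjInv_eq hf] at this
      _ = n / s + 1 := by rw [Set.ncard_coe_finset, Finset.card_range]

/-- Induction on the number `k` of vertices not yet absorbed. At `k = 0` only blocks are left, at
most `n / s + 1 ≤ d` of them, and no care is needed any more. -/
theorem IsBlockMap.hasContractionSeq {s d Δ : ℕ} (hs : 0 < s) (G : SimpleGraph (Fin n))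
    (hn : 0 < n) (hΔ : ∀ v, (G.neighborSet v).ncard ≤ Δ) (h1 : s * Δ ≤ d) (h2 : n / s + 1 ≤ d)
    (k : ℕ) {t : ℕ} (ht : t + k = n) {W : Type} {f : Fin n → W} (h : IsBlockMap s t f)
    (hf : Function.Surjective f) : HasContractionSeq d (quotient G f) := by
  induction k generalizing t W with
  | zero =>
    have : Finite W := Finite.of_surjective f hf
    have : Nonempty W := ⟨f ⟨0, hn⟩⟩
    have hpos : 0 < Nat.card W := Nat.card_pos
    refine hasContractionSeq_of_card_le (k := Nat.card W - 1) _ (by omega) ?_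
    have : Nat.card W ≤ Nat.card (Finset.range (n / s + 1)) := by
      refine Nat.card_le_card_of_injective (fun b => ⟨((Function.surjInv hf b : Fin n) : ℕ) / s,
        by simpa using Nat.lt_succ_of_le (Nat.div_le_div_right (Fin.is_lt _).le)⟩) ?_
      intro b b' hbb
      simp only [Subtype.mk.injEq] at hbb
      have := (h (Function.surjInv hf b) (Function.surjInv hf b')).2
        (.inr ⟨hbb, by omega, by omega⟩)
      rwa [Function.surjInv_eq hf, Function.surjInv_eq hf] at this
    simp only [Nat.card_eq_fintype_card, Fintype.card_coe, Finset.card_range] at this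
    omega
  | succ k ih =>
    by_cases hts : t % s = 0
    -- Vertex `t` opens a new block and is alone in it: the partition is unchanged and nothing is
    -- contracted.
    · refine ih (t := t + 1) (by omega) ?_ hf
      have key : ∀ x : Fin n, (x : ℕ) < t → (x : ℕ) / s ≠ t / s := by
        intro x hx hxt
        have e1 := Nat.div_add_mod x s
        have e2 := Nat.div_add_mod t s
        rw [hxt] at e1
        omega
      intro x y
      rw [h x y]
      refine or_congr_right' fun hne => and_congr_right fun hxy => ?_
      have hne' : (x : ℕ) ≠ y := fun h => hne (Fin.ext h)
      constructor
      · omega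
      · rintro ⟨hx, hy⟩
        rcases Nat.lt_succ_iff_lt_or_eq.1 hx with hx | hx <;>
          rcases Nat.lt_succ_iff_lt_or_eq.1 hy with hy | hy
        · exact ⟨hx, hy⟩
        · rw [hy] at hxy; exact (key x hx hxy).elim
        · rw [hx] at hxy; exact (key y hy hxy.symm).elim
        · omega
    · have ht0 : 0 < t := Nat.pos_of_ne_zero (by rintro rfl; simp at hts)
      have hdiv : (t - 1) / s = t / s := by
        have e2 := Nat.div_add_mod t s
        have e3 := Nat.mod_lt t hs
        refine Nat.div_eq_of_lt_le ?_ ?_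
        · rw [mul_comm]; omega
        · rw [add_mul, one_mul, mul_comm]; omega
      -- Otherwise `t - 1` lies in the block that `t` must join.
      let u : Fin n := ⟨t - 1, by omega⟩
      let v : Fin n := ⟨t, by omega⟩
      have hfu : ∀ x, f x = f u ↔ (x : ℕ) / s = t / s ∧ (x : ℕ) < t := by
        intro x
        rw [h x u, ← hdiv, Fin.ext_iff]
        change (x : ℕ) = t - 1 ∨ (x : ℕ) / s = (t - 1) / s ∧ (x : ℕ) < t ∧ t - 1 < t ↔ _
        constructor
        · rintro (hx | hx)
          · rw [hx]; exact ⟨rfl, by omega⟩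
          · exact ⟨hx.1, hx.2.1⟩
        · exact fun hx => .inr ⟨hx.1, hx.2, by omega⟩
      have hfv : ∀ x, f x = f v ↔ (x : ℕ) = t := by
        intro x
        rw [h x v, Fin.ext_iff]
        change (x : ℕ) = t ∨ (x : ℕ) / s = t / s ∧ (x : ℕ) < t ∧ t < t ↔ _
        omega
      refine .step _ (h.redDegree_le hs hf G hΔ h1 h2) (f u) (f v) ?_ ?_
      · intro huv
        have := (hfv u).1 huv
        change t - 1 = t at this
        omega
      · rw [contract_quotient G hf]
        refine ih (t := t + 1) (by omega) ?_ ((identify_surjective _ _).comp hf)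
        intro x y
        simp only [Function.comp_apply]
        rw [identify_eq_identify, hfu, hfu, hfv, hfv, h x y]
        constructor
        · rintro ((h | h) | ⟨h | h, h' | h'⟩)
          · exact .inl h
          · exact .inr ⟨h.1, by omega, by omega⟩
          · exact .inr ⟨h.1.trans h'.1.symm, by omega, by omega⟩
          · exact .inr ⟨by rw [h.1, h'], by omega, by omega⟩
          · exact .inr ⟨by rw [h, h'.1], by omega, by omega⟩
          · exact .inl (Fin.ext (h.trans h'.symm))
        · rintro (h | ⟨hxy, hx, hy⟩)
          · exact .inl (.inl h)
          · by_cases hx' : (x : ℕ) = t <;> by_cases hy' : (y : ℕ) = t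
            · exact .inr ⟨.inr hx', .inr hy'⟩
            · exact .inr ⟨.inr hx', .inl ⟨by rw [← hxy, hx'], by omega⟩⟩
            · exact .inr ⟨.inl ⟨by rw [hxy, hy'], by omega⟩, .inr hy'⟩
            · exact .inl (.inr ⟨hxy, by omega, by omega⟩)

end Blocks

end Trigraph

/-- A graph with maximum degree at most `Δ` has twin-width at most `max (s * Δ) (n / s + 1)`. -/
theorem twinWidth_le_of_degree_le {n s d Δ : ℕ} (hs : 0 < s) (G : SimpleGraph (Fin n)) (hn : 0 < n)
    (hΔ : ∀ v, (G.neighborSet v).ncard ≤ Δ) (h1 : s * Δ ≤ d) (h2 : n / s + 1 ≤ d) :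
    twinWidth G ≤ d := by
  refine Nat.sInf_le ?_
  change Trigraph.HasContractionSeq d (Trigraph.ofGraph G)
  rw [← Trigraph.quotient_id]
  refine Trigraph.IsBlockMap.hasContractionSeq hs G hn hΔ h1 h2 n (t := 0) (zero_add n) ?_
    Function.surjective_id
  intro x y
  simp

namespace Trigraph

/-! ### A balanced partition inside every contraction sequence -/

section FiberMass

variable {V : Type*} [Fintype V] {W : Type u}

open Classical in
/-- The size of the fibre of `f` over `a`. -/
noncomputable def fiberCard (f : V → W) (a : W) : ℕ := (Finset.univ.filter fun x => f x = a).card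

open Classical in
/-- The number of elements in fibres of size at least `s`. -/
noncomputable def bigMass (s : ℕ) (f : V → W) : ℕ :=
  (Finset.univ.filter fun x => s ≤ fiberCard f (f x)).card

open Classical in
/-- The number of elements in fibres of size less than `s`. -/
noncomputable def smallMass (s : ℕ) (f : V → W) : ℕ :=
  (Finset.univ.filter fun x => fiberCard f (f x) < s).card

theorem bigMass_add_smallMass (s : ℕ) (f : V → W) :
    bigMass s f + smallMass s f = Fintype.card V := by
  classical
  have := Finset.card_filter_add_card_filter_not (s := (Finset.univ : Finset V))
    (fun x => s ≤ fiberCard f (f x))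
  simp only [not_le, Finset.card_univ] at this
  exact this

theorem fiberCard_comp_of_injective {W' : Type*} (f : V → W) {i : W → W'}
    (hi : Function.Injective i) (a : W) : fiberCard (i ∘ f) (i a) = fiberCard f a := by
  classical
  unfold fiberCard
  congr 1
  ext x
  simp [hi.eq_iff]

theorem bigMass_comp_of_injective {W' : Type*} (s : ℕ) (f : V → W) {i : W → W'}
    (hi : Function.Injective i) : bigMass s (i ∘ f) = bigMass s f := by
  classical
  unfold bigMass
  congr 1
  ext x
  simp [fiberCard_comp_of_injective f hi]

/-- Only the fibres over `u` and `v` change, and each holds at most `s` of the vertices counted. -/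
theorem smallMass_le_smallMass_identify (s : ℕ) (f : V → W) (u v : W) :
    smallMass s f ≤ smallMass s (identify u v ∘ f) + 2 * s := by
  classical
  have hfib : ∀ w, (Finset.univ.filter fun x => fiberCard f (f x) < s ∧ f x = w).card ≤ s := by
    intro w
    by_cases hw : fiberCard f w < s
    · refine le_trans (Finset.card_le_card ?_) hw.le
      exact Finset.monotone_filter_right _ fun x _ h => h.2
    · rw [Finset.filter_false_of_mem]
      · simp
      · rintro x - ⟨h, rfl⟩
        exact hw h
  have hsub : (Finset.univ.filter fun x => fiberCard f (f x) < s) ⊆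
      (Finset.univ.filter fun x => fiberCard (identify u v ∘ f) ((identify u v ∘ f) x) < s) ∪
      ((Finset.univ.filter fun x => fiberCard f (f x) < s ∧ f x = u) ∪
      (Finset.univ.filter fun x => fiberCard f (f x) < s ∧ f x = v)) := by
    intro x
    simp only [Finset.mem_union, Finset.mem_filter, Finset.mem_univ, true_and]
    intro hx
    by_cases hu : f x = u
    · exact .inr (.inl ⟨hx, hu⟩)
    by_cases hv : f x = v
    · exact .inr (.inr ⟨hx, hv⟩)
    refine .inl ?_
    have : fiberCard (identify u v ∘ f) ((identify u v ∘ f) x) = fiberCard f (f x) := by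
      unfold fiberCard
      congr 1
      ext y
      simp only [Function.comp_apply, Finset.mem_filter, Finset.mem_univ, true_and,
        identify_eq_identify]
      tauto
    rwa [this]
  calc smallMass s f ≤ _ := Finset.card_le_card hsub
    _ ≤ _ := Finset.card_union_le _ _
    _ ≤ smallMass s (identify u v ∘ f) + (s + s) :=
      Nat.add_le_add_left ((Finset.card_union_le _ _).trans (Nat.add_le_add (hfib u) (hfib v))) _
    _ = _ := by ring

/-- A contraction sequence passes through a partition in which about half of the vertices lie in
parts of size at least `s`. -/
theorem HasContractionSeq.exists_balanced {V : Type u} [Fintype V] {d s : ℕ} {G : SimpleGraph V}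
    (hs : s ≤ Fintype.card V) {T : Trigraph W} (hT : HasContractionSeq d T) {f : V → W}
    (hf : Function.Surjective f) (hTf : T = quotient G f) (hbig : 2 * bigMass s f < Fintype.card V) :
    ∃ (W' : Type u) (g : V → W'), Function.Surjective g ∧
      (∀ w, (quotient G g).redDegree w ≤ d) ∧ Fintype.card V ≤ 2 * bigMass s g ∧
      Fintype.card V ≤ 2 * smallMass s g + 4 * s := by
  classical
  induction hT with
  | @single W T hd h =>
    -- With a single part, of size `|V| ≥ s`, all the mass is big.
    exfalso
    have : bigMass s f = Fintype.card V := by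
      unfold bigMass
      rw [Finset.filter_true_of_mem, Finset.card_univ]
      intro x _
      unfold fiberCard
      rw [Finset.filter_true_of_mem, Finset.card_univ]
      · exact hs
      · exact fun y _ => (Nat.card_eq_one_iff_unique.1 h).1.elim _ _
    omega
  | @step W T hd u v huv h ih =>
    have heq : T.contract u v = quotient G (identify u v ∘ f) := by
      rw [hTf, contract_quotient G hf]
    by_cases hb : 2 * bigMass s (identify u v ∘ f) < Fintype.card V
    · exact ih ((identify_surjective u v).comp hf) heq hb
    -- First time that the big mass reaches one half: just before, the small mass exceeded one half,
    -- and this contraction costs at most `2 * s` of it.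
    · refine ⟨_, identify u v ∘ f, (identify_surjective u v).comp hf, ?_, by omega, ?_⟩
      · rw [← heq]
        exact h.redDegree_le
      · have h1 := smallMass_le_smallMass_identify s f u v
        have h2 := bigMass_add_smallMass s f
        omega

open Classical in
/-- Every fibre of size at least `s` is mixed with at most `d` fibres of size less than `s`. -/
def FewMixed (d s : ℕ) (G : SimpleGraph V) (f : V → W) [Fintype W] : Prop :=
  ∀ a, s ≤ fiberCard f a →
    (Finset.univ.filter fun b => fiberCard f b < s ∧ Mixed G f a b).card ≤ d

/-- Small twin-width yields a balanced partition with few mixed pairs. -/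
theorem exists_fewMixed {V : Type u} [Fintype V] {d s : ℕ} {G : SimpleGraph V} (hs : 2 ≤ s)
    (hsV : s ≤ Fintype.card V) (hT : HasContractionSeq d (ofGraph G)) :
    ∃ f : V → V, FewMixed d s G f ∧ Fintype.card V ≤ 2 * bigMass s f ∧
      Fintype.card V ≤ 2 * smallMass s f + 4 * s := by
  classical
  have hbig : bigMass s (id : V → V) = 0 := by
    unfold bigMass
    rw [Finset.filter_false_of_mem, Finset.card_empty]
    intro x _
    have : fiberCard (id : V → V) x = 1 := Finset.card_eq_one.2 ⟨x, by ext; simp⟩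
    simp only [id, this]
    omega
  obtain ⟨W, g, hg, hd, h1, h2⟩ := hT.exists_balanced (G := G) hsV Function.surjective_id
    (quotient_id G).symm (by omega)
  -- Naming each part by one of its vertices makes the partition a map `V → V`, so that a later
  -- union bound runs over finitely many maps.
  set i := Function.surjInv hg with hi
  have hii : Function.Injective i := Function.injective_surjInv hg
  have hb := bigMass_comp_of_injective s g hii
  have hsm : smallMass s (i ∘ g) = smallMass s g := by
    have e1 := bigMass_add_smallMass s g
    have e2 := bigMass_add_smallMass s (i ∘ g)
    omega
  refine ⟨i ∘ g, ?_, by omega, by omega⟩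
  intro a ha
  have hex : ∃ x, i (g x) = a := by
    by_contra hne
    push Not at hne
    unfold fiberCard at ha
    rw [Finset.filter_false_of_mem (by simpa using hne), Finset.card_empty] at ha
    omega
  obtain ⟨x, rfl⟩ := hex
  have : Finite W := Finite.of_surjective g hg
  refine le_trans ?_ (hd (g x))
  have hsub : ((Finset.univ.filter fun b => fiberCard (i ∘ g) b < s ∧
      Mixed G (i ∘ g) (i (g x)) b : Finset V) : Set V) ⊆
      i '' (quotient G g).red.neighborSet (g x) := by
    intro b hbm
    simp only [Finset.coe_filter, Finset.mem_univ, true_and, Set.mem_ofPred_eq] at hbm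
    obtain ⟨hbs, ⟨y, z, hy, rfl, hyz⟩, y', z', hy', hz', hyz'⟩ := hbm
    refine ⟨g z, ⟨?_, ⟨y, z, hii hy, rfl, hyz⟩, y', z', hii hy', hii hz', hyz'⟩, rfl⟩
    intro hxz
    simp only [Function.comp_apply, ← hxz] at hbs ha
    omega
  rw [← Set.ncard_coe_finset]
  exact (Set.ncard_le_ncard hsub (Set.toFinite _)).trans (Set.ncard_image_le (Set.toFinite _))

end FiberMass

end Trigraph

/-! ### Independence of edges in the binomial random graph -/

namespace SimpleGraph

open MeasureTheory ProbabilityTheory unitInterval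

variable {V : Type*}

instance [Countable V] : MeasurableSingletonClass (SimpleGraph V) where
  measurableSet_singleton G := by
    have := measurable_edgeSet (V := V) (measurableSet_singleton G.edgeSet)
    convert this
    ext H
    simp

theorem measurable_mem_edgeSet (e : Sym2 V) : Measurable fun G : SimpleGraph V => e ∈ G.edgeSet :=
  measurable_set_iff.1 measurable_edgeSet e

theorem measurable_fromEdgeSet_ofPred :
    Measurable fun ω : Sym2 V → Prop => fromEdgeSet {e | ω e} :=
  measurable_fromEdgeSet.comp MeasurableEquiv.setOfPred.measurable

theorem binomialRandom_eq_map_infinitePi [Countable V] (p : I) :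
    binomialRandom V p = Measure.map (fun ω : Sym2 V → Prop => fromEdgeSet {e | ω e})
      (Measure.infinitePi fun e : Sym2 V =>
        toNNReal p • Measure.dirac (e ∈ (Sym2.diagSetᶜ : Set (Sym2 V))) + toNNReal (σ p) • Measure.dirac False) := by
  rw [binomialRandom_eq_map, setBernoulli_eq_map]
  exact Measure.map_map measurable_fromEdgeSet MeasurableEquiv.setOfPred.measurable

/-- The edge indicators of the binomial random graph are independent. -/
theorem iIndepFun_mem_edgeSet [Countable V] (p : I) :
    iIndepFun (fun (e : Sym2 V) (G : SimpleGraph V) => e ∈ G.edgeSet) (binomialRandom V p) := by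
  rw [iIndepFun_iff_map_fun_eq_infinitePi_map measurable_mem_edgeSet,
    binomialRandom_eq_map_infinitePi, Measure.map_map _ measurable_fromEdgeSet_ofPred]
  · simp_rw [Measure.map_map (measurable_mem_edgeSet _) measurable_fromEdgeSet_ofPred]
    have := iIndepFun_infinitePi (P := fun e : Sym2 V =>
        toNNReal p • Measure.dirac (e ∈ (Sym2.diagSetᶜ : Set (Sym2 V))) + toNNReal (σ p) • Measure.dirac False)
        -- `fromEdgeSet` discards diagonal pairs, so the edge indicator is the coordinate cut down
        -- in this way.
        (X := fun e (q : Prop) => q ∧ ¬ e.IsDiag) (fun e => .of_discrete)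
    rw [iIndepFun_iff_map_fun_eq_infinitePi_map] at this
    · have h1 : ∀ e : Sym2 V, ((fun G : SimpleGraph V => e ∈ G.edgeSet) ∘
          fun ω : Sym2 V → Prop => fromEdgeSet {e | ω e}) = fun ω => ω e ∧ ¬ e.IsDiag := by
        intro e
        ext ω
        simp
      have h2 : ((fun (G : SimpleGraph V) (e : Sym2 V) => e ∈ G.edgeSet) ∘
          fun ω : Sym2 V → Prop => fromEdgeSet {e | ω e}) = fun ω e => ω e ∧ ¬ e.IsDiag := by
        ext ω e
        simp
      simp_rw [h1, h2]
      exact this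
    · intro e
      exact Measurable.comp (g := fun q : Prop => q ∧ ¬ e.IsDiag) .of_discrete
        (measurable_pi_apply e)
  · exact measurable_pi_iff.2 measurable_mem_edgeSet

theorem binomialRandom_real_mem_edgeSet [Countable V] (p : I) {e : Sym2 V} (he : ¬ e.IsDiag) :
    (binomialRandom V p).real {G | e ∈ G.edgeSet} = p := by
  have hm : MeasurableSet {G : SimpleGraph V | e ∈ G.edgeSet} :=
    measurableSet_setOfPred.2 (measurable_mem_edgeSet e)
  rw [binomialRandom_eq_map_infinitePi, map_measureReal_apply measurable_fromEdgeSet_ofPred hm]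
  have : ((fun ω : Sym2 V → Prop => fromEdgeSet {e | ω e}) ⁻¹' {G : SimpleGraph V | e ∈ G.edgeSet})
      = (fun ω => ω e) ⁻¹' {True} := by
    ext ω
    simp [he]
  rw [this, ← map_measureReal_apply (measurable_pi_apply e) (by measurability), Measure.infinitePi_map_eval]
  simp [measureReal_def, he]

/-- Functions depending on disjoint sets of edges are independent. -/
theorem integral_mul_of_dependsOn [Finite V] (p : I) (S T : Finset (Sym2 V)) (hST : Disjoint S T)
    (φ ψ : SimpleGraph V → ℝ)
    (hφ : ∀ G H : SimpleGraph V, (∀ e ∈ S, e ∈ G.edgeSet ↔ e ∈ H.edgeSet) → φ G = φ H)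
    (hψ : ∀ G H : SimpleGraph V, (∀ e ∈ T, e ∈ G.edgeSet ↔ e ∈ H.edgeSet) → ψ G = ψ H) :
    ∫ G, φ G * ψ G ∂(binomialRandom V p) =
      (∫ G, φ G ∂(binomialRandom V p)) * ∫ G, ψ G ∂(binomialRandom V p) := by
  have hind := (iIndepFun_mem_edgeSet (V := V) p).indepFun_finset S T hST
    (fun e => by
      have : Measurable fun G : SimpleGraph V => e ∈ G.edgeSet := .of_discrete
      exact this)
  obtain ⟨φ', hφ'⟩ : ∃ φ' : (S → Prop) → ℝ, φ = φ' ∘ fun G (e : S) => (e : Sym2 V) ∈ G.edgeSet := by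
    refine (Function.factorsThrough_iff _).1 fun G H hGH => hφ G H fun e he => ?_
    exact iff_of_eq (congrFun hGH ⟨e, he⟩)
  obtain ⟨ψ', hψ'⟩ : ∃ ψ' : (T → Prop) → ℝ, ψ = ψ' ∘ fun G (e : T) => (e : Sym2 V) ∈ G.edgeSet := by
    refine (Function.factorsThrough_iff _).1 fun G H hGH => hψ G H fun e he => ?_
    exact iff_of_eq (congrFun hGH ⟨e, he⟩)
  have h2 : IndepFun φ ψ (binomialRandom V p) := by
    rw [hφ', hψ']
    exact hind.comp (.of_discrete) (.of_discrete)
  exact h2.integral_mul_eq_mul_integral .of_discrete .of_discrete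

theorem integral_prod_of_dependsOn [Finite V] (p : I) {κ : Type*} (K : Finset κ)
    (E : κ → Finset (Sym2 V)) (hE : (K : Set κ).PairwiseDisjoint E) (φ : κ → SimpleGraph V → ℝ)
    (hφ : ∀ k ∈ K, ∀ G H : SimpleGraph V,
      (∀ e ∈ E k, e ∈ G.edgeSet ↔ e ∈ H.edgeSet) → φ k G = φ k H) :
    ∫ G, ∏ k ∈ K, φ k G ∂(binomialRandom V p) = ∏ k ∈ K, ∫ G, φ k G ∂(binomialRandom V p) := by
  classical
  induction K using Finset.induction_on with
  | empty => simp
  | insert a K ha ih =>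
    simp only [Finset.prod_insert ha]
    rw [integral_mul_of_dependsOn p (E a) (K.biUnion E) ?_ _ _ (hφ a (by simp)), ih]
    · exact hE.subset (by simp)
    · exact fun k hk => hφ k (by simp [hk])
    · intro G H hGH
      refine Finset.prod_congr rfl fun k hk => hφ k (by simp [hk]) G H fun e he => hGH e ?_
      exact Finset.mem_biUnion.2 ⟨k, hk, he⟩
    · rw [Finset.disjoint_biUnion_right]
      intro k hk
      refine hE (by simp) (by simp [hk]) ?_
      rintro rfl
      exact ha hk

end SimpleGraph

/-! ### Homogeneous sets of pairs and the maximum degree -/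

namespace SimpleGraph

open MeasureTheory ProbabilityTheory unitInterval

variable {V : Type*}

-- The values `(1, 0)` and `(0, 1)` of `(a, b)` give the probabilities that all pairs are edges or
-- all are non-edges; `(exp 1, 1)` gives the exponential moment of a degree.
open Classical in
theorem integral_prod_ite_mem_edgeSet [Finite V] (p : I) (E : Finset (Sym2 V))
    (hE : ∀ e ∈ E, ¬ e.IsDiag) (a b : ℝ) :
    ∫ G, ∏ e ∈ E, (if e ∈ G.edgeSet then a else b) ∂(binomialRandom V p) =
      (p * a + (1 - p) * b) ^ E.card := by
  rw [integral_prod_of_dependsOn p E (fun e => {e}) ?_ (fun e G => if e ∈ G.edgeSet then a else b)]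
  · refine Finset.prod_eq_pow_card fun e he => ?_
    have h1 : ∀ G : SimpleGraph V, (if e ∈ G.edgeSet then a else b) =
        b + Set.indicator {G : SimpleGraph V | e ∈ G.edgeSet} (fun _ => a - b) G := by
      intro G
      by_cases h : e ∈ G.edgeSet <;> simp [h]
    simp_rw [h1]
    rw [integral_add (integrable_const _) .of_finite, integral_indicator_const _ .of_discrete,
      binomialRandom_real_mem_edgeSet p (hE e he)]
    simp
    ring
  · intro e _ G H h
    simp only [h e (by simp)]
  · intro e _ e' _ h
    simpa using h

theorem binomialRandom_real_forall_mem [Finite V] (p : I) (E : Finset (Sym2 V))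
    (hE : ∀ e ∈ E, ¬ e.IsDiag) :
    (binomialRandom V p).real {G | ∀ e ∈ E, e ∈ G.edgeSet} = (p : ℝ) ^ E.card := by
  classical
  have := integral_prod_ite_mem_edgeSet p E hE 1 0
  rw [mul_one, mul_zero, add_zero] at this
  rw [← this, ← integral_indicator_one .of_discrete]
  congr 1
  ext G
  rw [Finset.prod_ite_zero]
  simp [Set.indicator]

theorem binomialRandom_real_forall_notMem [Finite V] (p : I) (E : Finset (Sym2 V))
    (hE : ∀ e ∈ E, ¬ e.IsDiag) :
    (binomialRandom V p).real {G | ∀ e ∈ E, e ∉ G.edgeSet} = (1 - p : ℝ) ^ E.card := by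
  classical
  have := integral_prod_ite_mem_edgeSet p E hE 0 1
  rw [mul_one, mul_zero, zero_add] at this
  rw [← this, ← integral_indicator_one .of_discrete]
  congr 1
  ext G
  have h : ∏ e ∈ E, (if e ∈ G.edgeSet then (0 : ℝ) else 1) =
      ∏ e ∈ E, if e ∉ G.edgeSet then 1 else 0 :=
    Finset.prod_congr rfl fun e _ => by by_cases h : e ∈ G.edgeSet <;> simp [h]
  rw [h, Finset.prod_ite_zero]
  simp [Set.indicator]

/-- Two or more pairs are simultaneously edges, or simultaneously non-edges, with small
probability. -/
theorem binomialRandom_real_homogeneous_le [Finite V] (p : I) (hp : (p : ℝ) ≤ 1 / 2)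
    (E : Finset (Sym2 V)) (hE : ∀ e ∈ E, ¬ e.IsDiag) (h2 : 2 ≤ E.card) :
    (binomialRandom V p).real {G | (∀ e ∈ E, e ∉ G.edgeSet) ∨ ∀ e ∈ E, e ∈ G.edgeSet} ≤
      Real.exp (-(p * E.card / 2)) := by
  have h0 : (0 : ℝ) ≤ p := p.2.1
  obtain ⟨m, hm⟩ : ∃ m, E.card = m + 1 := ⟨E.card - 1, by omega⟩
  calc _ ≤ (binomialRandom V p).real {G | ∀ e ∈ E, e ∉ G.edgeSet} +
        (binomialRandom V p).real {G | ∀ e ∈ E, e ∈ G.edgeSet} := measureReal_union_le _ _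
    _ = (1 - p : ℝ) ^ (m + 1) + (p : ℝ) ^ (m + 1) := by
      rw [binomialRandom_real_forall_mem p E hE, binomialRandom_real_forall_notMem p E hE, hm]
    -- Replace `p ^ m` by `(1 - p) ^ m` in the second term. Later `m ≥ (m + 1) / 2` is needed, hence
    -- at least two pairs; a single pair is always homogeneous.
    _ ≤ (1 - p : ℝ) ^ m := by
      have : (p : ℝ) ^ m ≤ (1 - p : ℝ) ^ m := pow_le_pow_left₀ h0 (by linarith) m
      rw [pow_succ, pow_succ]
      nlinarith
    _ ≤ Real.exp (-p) ^ m :=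
      pow_le_pow_left₀ (by linarith) (Real.one_sub_le_exp_neg _) m
    _ ≤ _ := by
      rw [← Real.exp_nat_mul, hm, Real.exp_le_exp]
      have : (1 : ℝ) ≤ m := by exact_mod_cast (by omega : 1 ≤ m)
      push_cast
      nlinarith

/-- The maximum degree of the binomial random graph is rarely much larger than its mean. -/
theorem binomialRandom_real_exists_degree_gt_le [Fintype V] (p : I) :
    (binomialRandom V p).real {G | ∃ v, 6 * (p : ℝ) * Fintype.card V < ((G.neighborSet v).ncard : ℝ)} ≤
      (Fintype.card V : ℝ) * Real.exp (-(4 * (p : ℝ) * Fintype.card V)) := by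
  classical
  have h0 : (0 : ℝ) ≤ p := p.2.1
  set N : ℝ := (Fintype.card V : ℝ) with hN
  have hv : ∀ v : V, (binomialRandom V p).real
      {G | 6 * (p : ℝ) * N < ((G.neighborSet v).ncard : ℝ)} ≤ Real.exp (-(4 * (p : ℝ) * N)) := by
    intro v
    set E : Finset (Sym2 V) := (Finset.univ.filter fun x => x ≠ v).image fun x => s(v, x) with hE
    have hdiag : ∀ e ∈ E, ¬ e.IsDiag := by
      intro e he
      obtain ⟨x, hx, rfl⟩ := Finset.mem_image.1 he
      simpa using (Finset.mem_filter.1 hx).2.symm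
    have hcard : E.card ≤ Fintype.card V := Finset.card_image_le.trans (Finset.card_le_univ _)
    have hprod : ∀ G : SimpleGraph V, Real.exp ((G.neighborSet v).ncard : ℝ) =
        ∏ e ∈ E, if e ∈ G.edgeSet then Real.exp 1 else 1 := by
      intro G
      rw [hE, Finset.prod_image (by simp), ← Finset.prod_filter, Finset.prod_const,
        ← Real.exp_nat_mul, mul_one]
      congr 2
      rw [← Set.ncard_coe_finset]
      congr 1
      ext x
      simp only [mem_neighborSet, mem_edgeSet, Finset.coe_filter, Finset.mem_univ, true_and,
        Finset.mem_filter, Set.mem_ofPred_eq]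
      exact ⟨fun h => ⟨h.ne', h⟩, fun h => h.2⟩
    -- The exponential moment of the degree is at most `exp (2pN)` since `e - 1 ≤ 2`; Markov's
    -- inequality at `exp (6pN)` leaves `exp (-4pN)`.
    have hint := integral_prod_ite_mem_edgeSet p E hdiag (Real.exp 1) 1
    simp_rw [← hprod] at hint
    have hmarkov := mul_meas_ge_le_integral_of_nonneg (μ := binomialRandom V p)
      (f := fun G => Real.exp ((G.neighborSet v).ncard : ℝ))
      (Eventually.of_forall fun G => (Real.exp_pos _).le) .of_finite (Real.exp (6 * (p : ℝ) * N))
    have hle : (binomialRandom V p).real {G | 6 * (p : ℝ) * N < ((G.neighborSet v).ncard : ℝ)} ≤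
        (binomialRandom V p).real
          {G | Real.exp (6 * (p : ℝ) * N) ≤ Real.exp ((G.neighborSet v).ncard : ℝ)} := by
      refine measureReal_mono ?_
      intro G hG
      exact Real.exp_le_exp.2 (le_of_lt hG)
    rw [hint] at hmarkov
    have hbound : (p * Real.exp 1 + (1 - p) * 1 : ℝ) ^ E.card ≤ Real.exp (2 * (p : ℝ) * N) := by
      have he : Real.exp 1 ≤ 3 := Real.exp_one_lt_three.le
      calc (p * Real.exp 1 + (1 - p) * 1 : ℝ) ^ E.card ≤ (Real.exp (2 * p)) ^ E.card := by
            refine pow_le_pow_left₀ ?_ ?_ _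
            · have := p.2.2
              have := Real.exp_pos 1
              nlinarith [mul_nonneg h0 this.le]
            · have := Real.add_one_le_exp (2 * p : ℝ)
              nlinarith
        _ = Real.exp (E.card * (2 * p)) := by rw [← Real.exp_nat_mul]
        _ ≤ _ := by
            rw [Real.exp_le_exp]
            have : (E.card : ℝ) ≤ N := Nat.cast_le.2 hcard
            nlinarith
    have hpos := Real.exp_pos (6 * (p : ℝ) * N)
    have hfin : (binomialRandom V p).real {G | 6 * (p : ℝ) * N < ((G.neighborSet v).ncard : ℝ)} *
        Real.exp (6 * (p : ℝ) * N) ≤ Real.exp (2 * (p : ℝ) * N) := by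
      calc _ ≤ _ := mul_le_mul_of_nonneg_right hle hpos.le
        _ ≤ _ := by rw [mul_comm]; exact hmarkov.trans hbound
    rw [← le_div_iff₀ hpos, ← Real.exp_sub] at hfin
    refine hfin.trans (le_of_eq ?_)
    congr 1
    ring
  calc _ = (binomialRandom V p).real
        (⋃ v ∈ (Finset.univ : Finset V), {G | 6 * (p : ℝ) * N < ((G.neighborSet v).ncard : ℝ)}) := by
        congr 1
        ext G
        simp
    _ ≤ ∑ v ∈ (Finset.univ : Finset V), (binomialRandom V p).real
        {G | 6 * (p : ℝ) * N < ((G.neighborSet v).ncard : ℝ)} := measureReal_biUnion_finset_le _ _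
    _ ≤ ∑ v ∈ (Finset.univ : Finset V), Real.exp (-(4 * (p : ℝ) * N)) :=
        Finset.sum_le_sum fun v _ => hv v
    _ = _ := by simp [hN]

end SimpleGraph

/-! ### Few mixed pairs are unlikely for a fixed partition -/

namespace Trigraph

open MeasureTheory ProbabilityTheory unitInterval SimpleGraph

section FewMixed

variable {V : Type u} [Fintype V]

open Classical in
/-- The pairs with one element in the fibre over `a` and the other in the fibre over `b`. -/
noncomputable def crossPairs (f : V → V) (a b : V) : Finset (Sym2 V) :=
  ((Finset.univ.filter fun x => f x = a) ×ˢ (Finset.univ.filter fun x => f x = b)).image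
    fun q => s(q.1, q.2)

theorem mem_crossPairs {f : V → V} {a b : V} {e : Sym2 V} :
    e ∈ crossPairs f a b ↔ ∃ x y, f x = a ∧ f y = b ∧ s(x, y) = e := by
  simp [crossPairs, and_assoc]

theorem card_crossPairs (f : V → V) {a b : V} (hab : a ≠ b) :
    (crossPairs f a b).card = fiberCard f a * fiberCard f b := by
  classical
  unfold crossPairs
  rw [Finset.card_image_of_injOn, Finset.card_product]
  · rfl
  · rintro ⟨x, y⟩ h ⟨x', y'⟩ h' heq
    simp only [Finset.coe_product, Set.mem_prod, Finset.coe_filter, Finset.mem_univ, true_and,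
      Set.mem_ofPred_eq] at h h'
    rcases Sym2.eq_iff.1 heq with ⟨h1, h2⟩ | ⟨h1, h2⟩
    · exact Prod.ext h1 h2
    · simp only at h1 h2
      refine (hab ?_).elim
      rw [← h.1, h1, h'.2]

theorem not_mixed_iff {G : SimpleGraph V} {f : V → V} {a b : V} :
    ¬ Mixed G f a b ↔ (∀ e ∈ crossPairs f a b, e ∉ G.edgeSet) ∨
      ∀ e ∈ crossPairs f a b, e ∈ G.edgeSet := by
  simp only [Mixed, mem_crossPairs]
  rw [not_and_or]
  push Not
  refine or_congr ?_ ?_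
  · constructor
    · rintro h _ ⟨x, y, hx, hy, rfl⟩
      exact h x y hx hy
    · exact fun h x y hx hy => h _ ⟨x, y, hx, hy, rfl⟩
  · constructor
    · rintro h _ ⟨x, y, hx, hy, rfl⟩
      exact h x y hx hy
    · exact fun h x y hx hy => h _ ⟨x, y, hx, hy, rfl⟩

/-- With `t = exp (-y/2)` and `r = exp (-l) ≤ t / 2`, the claim reduces to `r + (1 - r)t² ≤ t`, that
is, to `0 ≤ (1 - t)(t - r(1 + t))`. -/
theorem exp_neg_add_mul_le {y l q : ℝ} (hy : 0 ≤ y) (hl : y / 2 + Real.log 2 ≤ l)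
    (hq : q ≤ Real.exp (-y)) :
    Real.exp (-l) + (1 - Real.exp (-l)) * q ≤ Real.exp (-(y / 2)) := by
  set t := Real.exp (-(y / 2)) with ht
  have ht0 : 0 < t := Real.exp_pos _
  have ht1 : t ≤ 1 := Real.exp_le_one_iff.2 (by linarith)
  have hsq : Real.exp (-y) = t * t := by rw [ht, ← Real.exp_add]; congr 1; ring
  have hle : Real.exp (-l) ≤ t / 2 := by
    calc Real.exp (-l) ≤ Real.exp (-(y / 2) - Real.log 2) := Real.exp_le_exp.2 (by linarith)
      _ = t / 2 := by rw [Real.exp_sub, Real.exp_log two_pos]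
  rw [hsq] at hq
  set r := Real.exp (-l)
  have hr : r ≤ 1 := by linarith
  have h1 : (1 - r) * q ≤ (1 - r) * (t * t) := mul_le_mul_of_nonneg_left hq (by linarith)
  have h2 : 0 ≤ (1 - t) * (t - r * (1 + t)) := by
    refine mul_nonneg (by linarith) ?_
    nlinarith
  nlinarith

-- Bounds one factor of the exponential moment. Fibre product `1` is excluded because a single pair
-- is never mixed; product `0` is harmless, as the bound is then `1`.
open Classical in
theorem integral_ite_mixed_le (p : I) (hp : (p : ℝ) ≤ 1 / 2) {f : V → V} {a b : V} (hab : a ≠ b)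
    (h2 : fiberCard f a * fiberCard f b ≠ 1) {l : ℝ}
    (hl : (p : ℝ) * (fiberCard f a * fiberCard f b) / 4 + Real.log 2 ≤ l) :
    ∫ G, (if Mixed G f a b then Real.exp (-l) else 1) ∂(binomialRandom V p) ≤
      Real.exp (-(p * (fiberCard f a * fiberCard f b) / 4)) := by
  have h0 : (0 : ℝ) ≤ p := p.2.1
  have hl0 : 0 ≤ l := by
    have := Real.log_nonneg (by norm_num : (1 : ℝ) ≤ 2)
    have : (0 : ℝ) ≤ p * (fiberCard f a * fiberCard f b) / 4 := by positivity
    linarith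
  have h1 : ∀ G : SimpleGraph V, (if Mixed G f a b then Real.exp (-l) else 1) =
      Real.exp (-l) + Set.indicator {G : SimpleGraph V | ¬ Mixed G f a b}
        (fun _ => 1 - Real.exp (-l)) G := by
    intro G
    by_cases h : Mixed G f a b <;> simp [h]
  simp_rw [h1]
  rw [integral_add (integrable_const _) .of_finite, integral_indicator_const _ .of_discrete]
  simp only [integral_const, probReal_univ, smul_eq_mul, one_mul]
  have hy : (p : ℝ) * (fiberCard f a * fiberCard f b) / 4 =
    (p * (fiberCard f a * fiberCard f b) / 2 : ℝ) / 2 := by ring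
  rw [hy] at hl ⊢
  rw [mul_comm ((binomialRandom V p).real _)]
  refine exp_neg_add_mul_le (by positivity) hl ?_
  rcases Nat.eq_zero_or_pos (fiberCard f a * fiberCard f b) with hz | hpos
  · have : ((fiberCard f a : ℝ) * fiberCard f b) = 0 := by exact_mod_cast hz
    rw [this]
    simp
  · simp_rw [not_mixed_iff]
    have hc := card_crossPairs f hab
    have := binomialRandom_real_homogeneous_le p hp (crossPairs f a b) ?_ (by omega)
    · rw [hc] at this
      push_cast at this
      exact this
    · intro e he
      obtain ⟨x, y, rfl, rfl, rfl⟩ := mem_crossPairs.1 he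
      intro hd
      exact hab (congrArg f (by simpa using hd))

theorem sum_fiberCard_eq_bigMass [DecidableEq V] (s : ℕ) (f : V → V) :
    ∑ a ∈ Finset.univ.filter (fun a => s ≤ fiberCard f a), fiberCard f a = bigMass s f := by
  classical
  unfold bigMass
  rw [Finset.card_eq_sum_card_fiberwise (f := f) (t := Finset.univ.filter
    (fun a => s ≤ fiberCard f a))]
  · refine Finset.sum_congr rfl fun a ha => ?_
    simp only [Finset.mem_filter, Finset.mem_univ, true_and] at ha
    conv_lhs => unfold fiberCard
    congr 1
    ext x
    simp only [Finset.mem_filter, Finset.mem_univ, true_and]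
    exact ⟨fun h => ⟨by rwa [h], h⟩, fun h => h.2⟩
  · intro x hx
    simpa using hx

theorem sum_fiberCard_eq_smallMass [DecidableEq V] (s : ℕ) (f : V → V) :
    ∑ a ∈ Finset.univ.filter (fun a => fiberCard f a < s), fiberCard f a = smallMass s f := by
  classical
  unfold smallMass
  rw [Finset.card_eq_sum_card_fiberwise (f := f) (t := Finset.univ.filter
    (fun a => fiberCard f a < s))]
  · refine Finset.sum_congr rfl fun a ha => ?_
    simp only [Finset.mem_filter, Finset.mem_univ, true_and] at ha
    conv_lhs => unfold fiberCard
    congr 1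
    ext x
    simp only [Finset.mem_filter, Finset.mem_univ, true_and]
    exact ⟨fun h => ⟨by rwa [h], h⟩, fun h => h.2⟩
  · intro x hx
    simpa using hx

/-- For a fixed partition, it is unlikely that every large part is mixed with few small parts. -/
theorem binomialRandom_real_fewMixed_le (p : I) (hp : (p : ℝ) ≤ 1 / 2) {s : ℕ} (hs : 2 ≤ s)
    (hps : 1 ≤ (p : ℝ) * (s * s)) (d : ℕ) (f : V → V) :
    (binomialRandom V p).real {G | FewMixed d s G f} ≤
      Real.exp (-(p * bigMass s f * (smallMass s f / 4 - s * d))) := by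
  classical
  have h0 : (0 : ℝ) ≤ p := p.2.1
  set B := Finset.univ.filter (fun a => s ≤ fiberCard f a) with hB
  set S := Finset.univ.filter (fun b => fiberCard f b < s) with hS
  -- The weight of a mixed pair grows with its large part, so that the cost `∑ l a * d` is
  -- proportional to the big mass.
  set l : V → ℝ := fun a => p * (fiberCard f a * s) with hl
  have hl0 : ∀ a, 0 ≤ l a := fun a => by positivity
  set φ : V × V → SimpleGraph V → ℝ :=
    fun k G => if Mixed G f k.1 k.2 then Real.exp (-l k.1) else 1 with hφ
  have hne : ∀ k ∈ B ×ˢ S, k.1 ≠ k.2 := by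
    rintro ⟨a, b⟩ hk h
    simp only [hB, hS, Finset.mem_product, Finset.mem_filter, Finset.mem_univ, true_and] at hk h
    subst h
    omega
  -- Exponential Markov inequality, pointwise: if each large part `a` has at most `d` mixed pairs,
  -- the total weight is at most `∑ l a * d`.
  have hpoint : ∀ G : SimpleGraph V, Set.indicator {G | FewMixed d s G f} (fun _ => (1 : ℝ)) G ≤
      Real.exp (∑ a ∈ B, l a * d) * ∏ k ∈ B ×ˢ S, φ k G := by
    intro G
    have hprod : ∏ k ∈ B ×ˢ S, φ k G = Real.exp (∑ a ∈ B,
        -(l a * (Finset.univ.filter fun b => fiberCard f b < s ∧ Mixed G f a b).card)) := by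
      rw [Finset.prod_product, Real.exp_sum]
      refine Finset.prod_congr rfl fun a _ => ?_
      simp only [hφ]
      rw [← Finset.prod_filter, Finset.prod_const, ← Real.exp_nat_mul, hS, Finset.filter_filter]
      congr 1
      ring
    rw [hprod, ← Real.exp_add, ← Finset.sum_add_distrib]
    by_cases hG : FewMixed d s G f
    · rw [Set.indicator_of_mem (by exact hG)]
      refine Real.one_le_exp (Finset.sum_nonneg fun a ha => ?_)
      have h1 := hG a (by simpa [hB] using ha)
      have h2 : ((Finset.univ.filter fun b => fiberCard f b < s ∧ Mixed G f a b).card : ℝ) ≤ d := by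
        exact_mod_cast h1
      have := mul_le_mul_of_nonneg_left h2 (hl0 a)
      linarith
    · rw [Set.indicator_of_notMem (by exact hG)]
      positivity
  have hblock : ∫ G, ∏ k ∈ B ×ˢ S, φ k G ∂(binomialRandom V p) =
      ∏ k ∈ B ×ˢ S, ∫ G, φ k G ∂(binomialRandom V p) := by
    refine integral_prod_of_dependsOn p (B ×ˢ S) (fun k => crossPairs f k.1 k.2) ?_ φ ?_
    · rintro ⟨a, b⟩ hk ⟨a', b'⟩ hk' hkk
      refine Finset.disjoint_left.2 fun e he he' => hkk ?_
      obtain ⟨x, y, hx, hy, rfl⟩ := mem_crossPairs.1 he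
      obtain ⟨x', y', hx', hy', heq⟩ := mem_crossPairs.1 he'
      simp only [hB, hS, Finset.coe_product, Finset.coe_filter, Finset.mem_univ, true_and,
        Set.mem_prod, Set.mem_ofPred_eq] at hk hk' hx hy hx' hy'
      rcases Sym2.eq_iff.1 heq with ⟨rfl, rfl⟩ | ⟨rfl, rfl⟩
      · rw [← hx, ← hy, ← hx', ← hy']
      -- A common edge read in opposite directions would put a vertex in a part both large and
      -- small.
      · have e1 := hk.2
        have e2 := hk'.1
        rw [← hy, hx'] at e1
        omega
    · intro k _ G H hGH
      have : Mixed G f k.1 k.2 ↔ Mixed H f k.1 k.2 := by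
        rw [← not_iff_not, not_mixed_iff, not_mixed_iff]
        refine or_congr ?_ ?_
        · exact forall₂_congr fun e he => not_congr (hGH e he)
        · exact forall₂_congr fun e he => hGH e he
      simp only [hφ, this]
  have hfactor : ∀ k ∈ B ×ˢ S, ∫ G, φ k G ∂(binomialRandom V p) ≤
      Real.exp (-(p * (fiberCard f k.1 * fiberCard f k.2) / 4)) := by
    intro k hk
    have hk' := hk
    simp only [hB, hS, Finset.mem_product, Finset.mem_filter, Finset.mem_univ, true_and] at hk'
    refine integral_ite_mixed_le p hp (hne k hk) ?_ ?_
    · intro h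
      have := Nat.eq_one_of_mul_eq_one_right h
      omega
    · have e1 : (s : ℝ) ≤ fiberCard f k.1 := by exact_mod_cast hk'.1
      have e2 : (fiberCard f k.2 : ℝ) ≤ s := by exact_mod_cast hk'.2.le
      have e3 : (p : ℝ) * (fiberCard f k.1 * fiberCard f k.2) ≤ l k.1 := by
        simp only [hl]
        gcongr
      -- Thus `l/4 + log 2 ≤ l`, because `log 2 < 3/4`.
      have e4 : 1 ≤ l k.1 := by
        refine hps.trans ?_
        simp only [hl]
        gcongr
      have := Real.log_two_lt_d9
      linarith
  calc (binomialRandom V p).real {G | FewMixed d s G f}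
      = ∫ G, Set.indicator {G | FewMixed d s G f} (fun _ => (1 : ℝ)) G ∂(binomialRandom V p) := by
        rw [integral_indicator_const _ .of_discrete]; simp
    _ ≤ ∫ G, Real.exp (∑ a ∈ B, l a * d) * ∏ k ∈ B ×ˢ S, φ k G ∂(binomialRandom V p) :=
        integral_mono .of_finite .of_finite hpoint
    _ = Real.exp (∑ a ∈ B, l a * d) * ∏ k ∈ B ×ˢ S, ∫ G, φ k G ∂(binomialRandom V p) := by
        rw [integral_const_mul, hblock]
    _ ≤ Real.exp (∑ a ∈ B, l a * d) *
        ∏ k ∈ B ×ˢ S, Real.exp (-(p * (fiberCard f k.1 * fiberCard f k.2) / 4)) := by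
        refine mul_le_mul_of_nonneg_left ?_ (Real.exp_pos _).le
        refine Finset.prod_le_prod (fun k _ => integral_nonneg fun G => ?_) hfactor
        simp only [hφ, Pi.zero_apply]
        split_ifs <;> positivity
    _ = _ := by
        have e1 : (∑ a ∈ B, (fiberCard f a : ℝ)) = bigMass s f := by
          exact_mod_cast sum_fiberCard_eq_bigMass s f
        have e2 : (∑ a ∈ S, (fiberCard f a : ℝ)) = smallMass s f := by
          exact_mod_cast sum_fiberCard_eq_smallMass s f
        rw [← Real.exp_sum, ← Real.exp_add]
        congr 1
        have e3 : ∑ a ∈ B, l a * d = p * (bigMass s f : ℝ) * (s * d) := by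
          rw [← e1, Finset.mul_sum, Finset.sum_mul]
          refine Finset.sum_congr rfl fun a _ => ?_
          simp only [hl]
          ring
        have e4 : ∑ k ∈ B ×ˢ S, -(p * ((fiberCard f k.1 : ℝ) * fiberCard f k.2) / 4) =
            -(p * ((bigMass s f : ℝ) * smallMass s f) / 4) := by
          rw [← e1, ← e2, Finset.sum_mul_sum, Finset.sum_product]
          simp only [Finset.sum_neg_distrib, Finset.mul_sum, Finset.sum_div]
        rw [e3, e4]
        ring

end FewMixed

end Trigraph

/-! ### Union bound and conclusion -/

section TwinWidth

open MeasureTheory SimpleGraph Trigraph unitInterval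

theorem hasContractionSeq_twinWidth {V : Type u} [Finite V] [Nonempty V] (G : SimpleGraph V) :
    (ofGraph G).HasContractionSeq (twinWidth G) :=
  Nat.sInf_mem (exists_hasContractionSeq (ofGraph G))

/-- If the twin-width of `G` is not of order `n√p`, then `G` has a vertex of large degree or a
balanced partition with few mixed pairs. -/
theorem degree_gt_or_fewMixed_of_twinWidth {n s : ℕ} {q : ℝ} (hn : 0 < n) (hq : 0 < q)
    (hqn : 16 ≤ q * n) (hs2 : 2 ≤ s) (hs1 : 1 / q ≤ s) (hs : s ≤ 2 / q) (G : SimpleGraph (Fin n))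
    (hG : ¬ (1 / 64 * (n * q) ≤ (twinWidth G : ℝ) ∧ (twinWidth G : ℝ) ≤ 12 * (n * q))) :
    (∃ v, 6 * (q * q) * n < ((G.neighborSet v).ncard : ℝ)) ∨
      ∃ f : Fin n → Fin n, (n ≤ 2 * bigMass s f ∧ n ≤ 2 * smallMass s f + 4 * s) ∧
        FewMixed ⌊1 / 64 * (n * q)⌋₊ s G f := by
  have hn0 : (0 : ℝ) < n := by exact_mod_cast hn
  have : Nonempty (Fin n) := ⟨⟨0, hn⟩⟩
  have hs0 : (0 : ℝ) < s := by exact_mod_cast (by omega : 0 < s)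
  have hsq : s * q ≤ 2 := (le_div_iff₀ hq).1 hs
  have hsq1 : 1 ≤ s * q := (div_le_iff₀ hq).1 hs1
  rw [or_iff_not_imp_left]
  intro hdeg
  push Not at hdeg
  -- Here `q` plays the role of `√p`. The constant is `2 * 6`, from `s * q ≤ 2` and the degree bound
  -- `6q²n`.
  have hupper : (twinWidth G : ℝ) ≤ 12 * (n * q) := by
    refine (Nat.le_floor_iff (by positivity)).1 (twinWidth_le_of_degree_le (s := s)
      (Δ := ⌊6 * (q * q) * n⌋₊) (by omega) G hn (fun v => Nat.le_floor (hdeg v)) ?_ ?_)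
    · refine Nat.le_floor ?_
      push_cast
      have h1 : (⌊6 * (q * q) * n⌋₊ : ℝ) ≤ 6 * (q * q) * n := Nat.floor_le (by positivity)
      calc (s : ℝ) * ⌊6 * (q * q) * n⌋₊ ≤ s * (6 * (q * q) * n) :=
            mul_le_mul_of_nonneg_left h1 hs0.le
        _ = (s * q) * (6 * (q * n)) := by ring
        _ ≤ 2 * (6 * (q * n)) := mul_le_mul_of_nonneg_right hsq (by positivity)
        _ = _ := by ring
    · refine Nat.le_floor ?_
      push_cast
      have h1 : ((n / s : ℕ) : ℝ) ≤ n / s := Nat.cast_div_le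
      have h2 : (n : ℝ) / s ≤ n * q := by
        rw [div_le_iff₀ hs0]
        nlinarith
      nlinarith
  have hlt : (twinWidth G : ℝ) < 1 / 64 * (n * q) := by
    by_contra h
    exact hG ⟨not_lt.1 h, hupper⟩
  have hsn : (s : ℝ) ≤ n := by
    have : s * 16 ≤ (s * q) * n := by rw [mul_assoc]; exact mul_le_mul_of_nonneg_left hqn hs0.le
    nlinarith
  obtain ⟨f, hf, h1, h2⟩ := exists_fewMixed (s := s) hs2
    (by rw [Fintype.card_fin]; exact_mod_cast hsn) (hasContractionSeq_twinWidth G)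
  rw [Fintype.card_fin] at h1 h2
  exact ⟨f, ⟨h1, h2⟩, fun a ha => (hf a ha).trans (Nat.le_floor hlt.le)⟩

/-- There are two bad events, a vertex of large degree and a balanced partition with few mixed
pairs; each has probability at most `1 / n`. -/
theorem le_binomialRandom_real_twinWidth {n : ℕ} (hn : 3 ≤ n) (p : I)
    (h1 : 726 * Real.log n / n ≤ (p : ℝ)) (h2 : (p : ℝ) ≤ 1 / 2) :
    1 - 2 / (n : ℝ) ≤ (binomialRandom (Fin n) p).real {G | 1 / 64 * (n * √(p : ℝ)) ≤
      (twinWidth G : ℝ) ∧ (twinWidth G : ℝ) ≤ 12 * (n * √(p : ℝ))} := by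
  classical
  have hn3 : (3 : ℝ) ≤ n := by exact_mod_cast hn
  have hn0 : (0 : ℝ) < n := by linarith
  have hlog : 1 ≤ Real.log n := by
    rw [Real.le_log_iff_exp_le hn0]
    exact Real.exp_one_lt_three.le.trans hn3
  rw [div_le_iff₀ hn0] at h1
  have hp0 : (0 : ℝ) < p := by
    by_contra h
    have : (p : ℝ) * n ≤ 0 := mul_nonpos_of_nonpos_of_nonneg (not_lt.1 h) hn0.le
    linarith
  set q := √(p : ℝ) with hq
  have hqq : q * q = p := Real.mul_self_sqrt hp0.le
  have hq0 : 0 < q := Real.sqrt_pos.2 hp0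
  have hq1 : q < 1 := by nlinarith
  have hqn : 16 ≤ q * n := by
    have : (16 : ℝ) * 16 ≤ (q * n) * (q * n) := by
      have : (q * n) * (q * n) = (p * n) * n := by rw [← hqq]; ring
      nlinarith
    exact nonneg_le_nonneg_of_sq_le_sq (by positivity) this
  set s := ⌈1 / q⌉₊ with hs
  have hs1 : 1 / q ≤ s := Nat.le_ceil _
  have hsq1 : 1 ≤ s * q := (div_le_iff₀ hq0).1 hs1
  have hs2 : 2 ≤ s := by
    have : (1 : ℝ) < s := (one_lt_one_div hq0 hq1).trans_le hs1
    exact_mod_cast this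
  have hsle : (s : ℝ) ≤ 2 / q := by
    have e1 := (Nat.ceil_lt_add_one (one_div_pos.2 hq0).le).le
    have e2 := (one_lt_one_div hq0 hq1).le
    calc (s : ℝ) ≤ 1 / q + 1 := e1
      _ ≤ 1 / q + 1 / q := by linarith
      _ = 2 / q := by ring
  have hsq : s * q ≤ 2 := (le_div_iff₀ hq0).1 hsle
  have hs8 : (s : ℝ) * 8 ≤ n := by
    have : s * 16 ≤ (s * q) * n := by
      rw [mul_assoc]; exact mul_le_mul_of_nonneg_left hqn (Nat.cast_nonneg _)
    nlinarith
  set d := ⌊1 / 64 * (n * q)⌋₊ with hd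
  have hsd : (s : ℝ) * d ≤ n / 32 := by
    have e1 : (d : ℝ) ≤ 1 / 64 * (n * q) := Nat.floor_le (by positivity)
    calc (s : ℝ) * d ≤ s * (1 / 64 * (n * q)) := mul_le_mul_of_nonneg_left e1 (Nat.cast_nonneg _)
      _ = (s * q) * (n / 64) := by ring
      _ ≤ 2 * (n / 64) := mul_le_mul_of_nonneg_right hsq (by positivity)
      _ = _ := by ring
  set F := Finset.univ.filter fun f : Fin n → Fin n =>
    n ≤ 2 * bigMass s f ∧ n ≤ 2 * smallMass s f + 4 * s with hF
  set A := {G : SimpleGraph (Fin n) | 1 / 64 * (n * q) ≤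
      (twinWidth G : ℝ) ∧ (twinWidth G : ℝ) ≤ 12 * (n * q)} with hA
  set U := {G : SimpleGraph (Fin n) | ∃ v, 6 * (p : ℝ) * Fintype.card (Fin n) <
    ((G.neighborSet v).ncard : ℝ)} with hU
  set L := ⋃ f ∈ F, {G : SimpleGraph (Fin n) | FewMixed d s G f} with hL
  have hsub : Aᶜ ⊆ U ∪ L := by
    intro G hG
    rcases degree_gt_or_fewMixed_of_twinWidth (by omega) hq0 hqn hs2 hs1 hsle G hG with h | h
    · left
      rw [hqq] at h
      simp only [hU, Fintype.card_fin]
      exact h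
    · right
      obtain ⟨f, hf, hfG⟩ := h
      exact Set.mem_biUnion (by simpa [hF] using hf) hfG
  have hUle : (binomialRandom (Fin n) p).real U ≤ 1 / n := by
    refine (binomialRandom_real_exists_degree_gt_le p).trans ?_
    rw [Fintype.card_fin]
    calc (n : ℝ) * Real.exp (-(4 * (p : ℝ) * n)) ≤ n * Real.exp (-(Real.log n + Real.log n)) := by
          refine mul_le_mul_of_nonneg_left (Real.exp_le_exp.2 ?_) hn0.le
          linarith
      _ = 1 / n := by
          rw [neg_add, Real.exp_add, Real.exp_neg, Real.exp_log hn0]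
          field_simp
  have hLle : (binomialRandom (Fin n) p).real L ≤ 1 / n := by
    calc (binomialRandom (Fin n) p).real L
        ≤ ∑ f ∈ F, (binomialRandom (Fin n) p).real {G | FewMixed d s G f} :=
          measureReal_biUnion_finset_le _ _
      _ ≤ ∑ f ∈ F, Real.exp (-((p * n) * n / 64)) := by
          refine Finset.sum_le_sum fun f hf => ?_
          refine (binomialRandom_real_fewMixed_le p h2 hs2 ?_ d f).trans (Real.exp_le_exp.2 ?_)
          · rw [← hqq]
            nlinarith
          · simp only [hF, Finset.mem_filter, Finset.mem_univ, true_and] at hf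
            have e1 : (n : ℝ) ≤ 2 * bigMass s f := by exact_mod_cast hf.1
            have e2 : (n : ℝ) ≤ 2 * smallMass s f + 4 * s := by exact_mod_cast hf.2
            -- As `s ≤ n/8`, the small mass is at least `n/4`; a quarter of it minus `s * d ≤ n/32`
            -- leaves `n/32`.
            have e3 : (n : ℝ) / 32 ≤ smallMass s f / 4 - s * d := by linarith
            have e4 : (n : ℝ) / 2 * (n / 32) ≤ bigMass s f * (smallMass s f / 4 - s * d) :=
              mul_le_mul (by linarith) e3 (by positivity) (Nat.cast_nonneg _)
            have e5 := mul_le_mul_of_nonneg_left e4 hp0.le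
            linarith
      _ ≤ (n : ℝ) ^ n * Real.exp (-((p * n) * n / 64)) := by
          rw [Finset.sum_const, nsmul_eq_mul]
          refine mul_le_mul_of_nonneg_right ?_ (Real.exp_pos _).le
          have : F.card ≤ n ^ n := (Finset.card_le_univ _).trans (by simp)
          exact_mod_cast this
      -- `pn ≥ 726 ln n` and `726/64 > 2`, with room to spare.
      _ ≤ Real.exp (n * Real.log n) * Real.exp (-(2 * (n * Real.log n))) := by
          rw [Real.exp_nat_mul, Real.exp_log hn0]
          refine mul_le_mul_of_nonneg_left (Real.exp_le_exp.2 ?_) (by positivity)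
          have := mul_le_mul_of_nonneg_right h1 hn0.le
          have : 0 ≤ n * Real.log n := by positivity
          linarith
      _ = Real.exp (-(n * Real.log n)) := by rw [← Real.exp_add]; congr 1; ring
      _ ≤ Real.exp (-Real.log n) := by
          refine Real.exp_le_exp.2 ?_
          nlinarith
      _ = 1 / n := by rw [Real.exp_neg, Real.exp_log hn0, one_div]
  have hcompl : (binomialRandom (Fin n) p).real Aᶜ ≤ 2 / n := by
    calc _ ≤ _ := measureReal_mono hsub
      _ ≤ _ := measureReal_union_le _ _
      _ ≤ 1 / n + 1 / n := add_le_add hUle hLle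
      _ = _ := by ring
  rw [probReal_compl_eq_one_sub .of_discrete] at hcompl
  linarith

end TwinWidth

theorem mainTheorem2 :
    ∃ c C : ℝ, 0 < c ∧ 0 < C ∧
      ∀ p : ℕ → unitInterval,
        (∀ᶠ n : ℕ in atTop,
          726 * Real.log (n : ℝ) / (n : ℝ) ≤ (p n : ℝ) ∧ (p n : ℝ) ≤ 1 / 2) →
        Tendsto
          (fun n : ℕ => (SimpleGraph.binomialRandom (Fin n) (p n)).real
            {G : SimpleGraph (Fin n) |
              c * ((n : ℝ) * √(p n : ℝ)) ≤ (twinWidth G : ℝ) ∧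
              (twinWidth G : ℝ) ≤ C * ((n : ℝ) * √(p n : ℝ))})
          atTop (𝓝 1) := by
  refine ⟨1 / 64, 12, by norm_num, by norm_num, fun p hp => ?_⟩
  have hlim : Tendsto (fun n : ℕ => 1 - 2 / (n : ℝ)) atTop (𝓝 1) := by
    simpa using (tendsto_const_div_atTop_nhds_zero_nat (2 : ℝ)).const_sub 1
  refine tendsto_of_tendsto_of_tendsto_of_le_of_le' hlim tendsto_const_nhds ?_ ?_
  · filter_upwards [hp, eventually_ge_atTop 3] with n hn hn3
    exact le_binomialRandom_real_twinWidth hn3 (p n) hn.1 hn.2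
  · exact Eventually.of_forall fun n => MeasureTheory.measureReal_le_one
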